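/- Fix a countably infinite domain $\mathbf D$ (the constants together with the nulls). A schema is a finite set of relation symbols of positive arities; an instance assigns to each symbol a finite relation on $\mathbf D$ of the right arity. A schema mapping from $\mathbf S$ to $\mathbf T$ is a set of pairs $(I,J)$ with $I$ an instance of $\mathbf S$ and $J$ an instance of $\mathbf T$; two mappings are equivalent if they consist of the same pairs, and $\mathcal M_{12}\circ\mathcal M_{23}=\{(I_1,I_3):\exists I_2\ (I_1,I_2)\in\mathcal M_{12},\ (I_2,I_3)\in\mathcal M_{23}\}$. An st-tgd is a sentence $\forall\bar x(\varphi(\bar x)\to\exists\bar y\,\psi(\bar x,\bar y))$ with $\varphi$ a conjunction of relational atoms over $\mathbf S$ and $\psi$ one over $\mathbf T$; a t-tgd is the same with both over $\mathbf T$; a t-egd is $\forall\bar x(\varphi(\bar x)\to u=v)$ with $\varphi$ a conjunction of relational atoms over $\mathbf T$ and $u,v$ in $\bar x$. In all three every variable of $\bar x$ occurs in $\varphi$. The dependency graph of a set of t-tgds has as nodes the positions $(T,i)$; for each t-tgd of the set and each $x\in\bar x$ occurring at position $p$ in $\varphi$ it has an edge from $p$ to every position of $x$ in $\psi$, and a special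 edge from $p$ to every position in $\psi$ of a variable of $\bar y$. The set is weakly acyclic if no cycle contains a special edge. An st-SO dependency is a sentence $\exists\bar f\,\bigwedge_{i=1}^n\forall\bar x_i(\varphi_i\to\psi_i)$ with $\bar f$ finitely many function symbols (arity $0$ allowed), where $\varphi_i$ is a conjunction of relational atoms over $\mathbf S$ whose arguments are variables of $\bar x_i$ and of equalities between terms over $\bar x_i,\bar f$; $\psi_i$ is a conjunction of relational atoms over $\mathbf T$ whose arguments are such terms and of equalities between such terms; and every variable of $\bar x_i$ occurs in a relational atom of $\varphi_i$. Conjunctions may be empty, meaning true. The functions range over all functions on $\mathbf D$. Variables and $0$-ary function symbols have depth $0$, and $f(t_1,\dots,t_k)$ with $k\ge 1$ has depth $1+\max_i\operatorname{depth}(t_i)$; the dependency is unnested if all its terms have depth at most $1$. A standard schema mapping is one specified by a finite set of st-tgds, a finite set of t-egds and a finite weakly acyclic set of t-tgds. An SO-standard schema mapping is one specified by a single st-SO dependency, a finite set of t-egds and a finite weakly acyclic set of t-tgds. Theorem. (1) Every SO-standard schema mapping is equivalent to a composition of finitely many (at least one) standard schema mappings. (2) Every schema mapping specified by a single st-SO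 dependency is equivalent to a composition of finitely many (at least one) schema mappings, each specified by a finite set of st-tgds and a finite set of t-egds (no t-tgds). (3) Every schema mapping specified by a single unnested st-SO dependency is equivalent to a composition $\mathcal M_{12}\circ\mathcal M_{23}$ of two schema mappings, each specified by a finite set of st-tgds and a finite set of t-egds. -/

import Mathlib

namespace DataExchange

/-! ## Schemas and instances -/

/-- A schema: finitely many relation symbols, each with a fixed positive arity. Two different
schemas never share a symbol, since the symbols of each form a type of their own. -/
structure Schema where
  Rel : Type
  finite_rel : Finite Rel
  arity : Rel → ℕ
  arity_pos : ∀ R, 0 < arity R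

/-- An instance of a schema over the domain `D` (the union of the constants and the nulls): every
relation symbol is interpreted by a finite relation on `D`. -/
@[ext]
structure Inst (D : Type) (S : Schema) where
  rel : (R : S.Rel) → Set (Fin (S.arity R) → D)
  finite_rel : ∀ R, (rel R).Finite

/-- A schema mapping from `S` to `T`: a set of pairs `(I, J)` of instances. Two schema mappings are
equivalent if they are equal as sets of pairs, and `SetRel.comp` is composition. -/
abbrev SchemaMapping (D : Type) (S T : Schema) : Type :=
  SetRel (Inst D S) (Inst D T)

/-- A relational atom `R(a₁, …, aₖ)` whose arguments are taken from `X`. -/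
structure Atom (S : Schema) (X : Type) where
  rel : S.Rel
  args : Fin (S.arity rel) → X

/-- `I` satisfies the atom when its arguments are evaluated by `v`. -/
def Atom.Holds {D X : Type} {S : Schema} (I : Inst D S) (v : X → D) (a : Atom S X) : Prop :=
  (fun i => v (a.args i)) ∈ I.rel a.rel

/-! ## First-order dependencies -/

/-- A tuple-generating dependency `∀ x̄ (φ(x̄) → ∃ ȳ ψ(x̄, ȳ))` with premise over `S` and conclusion
over `T`; the conjunctions are finite lists of atoms. The last field is the safety condition.
For `S` the source and `T` the target schema this is an st-tgd; for `S = T` it is a t-tgd. -/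
structure Tgd (S T : Schema) where
  nx : ℕ
  ny : ℕ
  premise : List (Atom S (Fin nx))
  conclusion : List (Atom T (Fin nx ⊕ Fin ny))
  safe : ∀ x, ∃ a ∈ premise, ∃ i, a.args i = x

/-- `(I, J) ⊨ ∀ x̄ (φ(x̄) → ∃ ȳ ψ(x̄, ȳ))`. -/
def Tgd.Sat {D : Type} {S T : Schema} (τ : Tgd S T) (I : Inst D S) (J : Inst D T) : Prop :=
  ∀ v : Fin τ.nx → D, (∀ a ∈ τ.premise, a.Holds I v) →
    ∃ w : Fin τ.ny → D, ∀ b ∈ τ.conclusion, b.Holds J (Sum.elim v w)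

/-- An equality-generating dependency `∀ x̄ (φ(x̄) → u = v)`, with the safety condition. -/
structure Egd (T : Schema) where
  nx : ℕ
  premise : List (Atom T (Fin nx))
  left : Fin nx
  right : Fin nx
  safe : ∀ x, ∃ a ∈ premise, ∃ i, a.args i = x

/-- `J ⊨ ∀ x̄ (φ(x̄) → u = v)`. -/
def Egd.Sat {D : Type} {T : Schema} (ε : Egd T) (J : Inst D T) : Prop :=
  ∀ v : Fin ε.nx → D, (∀ a ∈ ε.premise, a.Holds J v) → v ε.left = v ε.right

/-! ## Weak acyclicity -/

/-- A node `(T, i)` of the dependency graph: an attribute position of a relation symbol. -/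
abbrev Position (T : Schema) : Type := (R : T.Rel) × Fin (T.arity R)

/-- The element `x` occurs in the atom `a` at position `p`. -/
def Atom.OccursAt {S : Schema} {X : Type} (a : Atom S X) (x : X) (p : Position S) : Prop :=
  ∃ i : Fin (S.arity a.rel), a.args i = x ∧ p = ⟨a.rel, i⟩

/-- The edges `p → q` of the dependency graph: some universal variable occurs at `p` in the premise
and at `q` in the conclusion of some t-tgd of the set. -/
def RegularEdge {T : Schema} (Γ : Set (Tgd T T)) (p q : Position T) : Prop :=
  ∃ τ ∈ Γ, ∃ x : Fin τ.nx, (∃ a ∈ τ.premise, a.OccursAt x p) ∧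
    ∃ b ∈ τ.conclusion, b.OccursAt (Sum.inl x) q

/-- The special edges `p →* q` of the dependency graph: some universal variable occurs at `p` in the
premise, and some existential variable at `q` in the conclusion, of some t-tgd of the set. -/
def SpecialEdge {T : Schema} (Γ : Set (Tgd T T)) (p q : Position T) : Prop :=
  ∃ τ ∈ Γ, ∃ (x : Fin τ.nx) (y : Fin τ.ny), (∃ a ∈ τ.premise, a.OccursAt x p) ∧
    ∃ b ∈ τ.conclusion, b.OccursAt (Sum.inr y) q

/-- No cycle of the dependency graph goes through a special edge. -/
def WeaklyAcyclic {T : Schema} (Γ : Set (Tgd T T)) : Prop :=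
  ∀ p q : Position T, SpecialEdge Γ p q →
    ¬ Relation.ReflTransGen (fun a b => RegularEdge Γ a b ∨ SpecialEdge Γ a b) q p

/-! ## Source-to-target second-order dependencies -/

/-- Terms based on the variables `X` and the function symbols `Fn`, where `f` has arity `ar f`
(arity `0` is allowed). -/
inductive FnTerm {Fn : Type} (ar : Fn → ℕ) (X : Type) : Type
  | var (x : X) : FnTerm ar X
  | app (f : Fn) (args : Fin (ar f) → FnTerm ar X) : FnTerm ar X

/-- The depth of nesting: variables and `0`-ary function symbols have depth `0`, and any other
`f(t₁, …, tₖ)` has depth one more than the maximum of the depths of the `tᵢ`. -/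
def FnTerm.depth {Fn : Type} {ar : Fn → ℕ} {X : Type} : FnTerm ar X → ℕ
  | .var _ => 0
  | .app f args => if ar f = 0 then 0 else (Finset.univ.sup fun i => (args i).depth) + 1

/-- The value of a term, where `F` interprets the function symbols and `v` the variables. -/
def FnTerm.eval {Fn : Type} {ar : Fn → ℕ} {X D : Type} (F : (f : Fn) → (Fin (ar f) → D) → D)
    (v : X → D) : FnTerm ar X → D
  | .var x => v x
  | .app f args => F f fun i => (args i).eval F v

/-- A conjunct `∀ x̄ (φ → ψ)` of an st-SO dependency: `φ` is a conjunction of relational atoms over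
`S` in the variables and of equalities of terms, `ψ` is a conjunction of relational atoms over `T`
in terms and of equalities of terms. The last field is the safety condition. -/
structure SOClause (S T : Schema) {Fn : Type} (ar : Fn → ℕ) where
  nx : ℕ
  premiseRel : List (Atom S (Fin nx))
  premiseEq : List (FnTerm ar (Fin nx) × FnTerm ar (Fin nx))
  conclusionRel : List (Atom T (FnTerm ar (Fin nx)))
  conclusionEq : List (FnTerm ar (Fin nx) × FnTerm ar (Fin nx))
  safe : ∀ x, ∃ a ∈ premiseRel, ∃ i, a.args i = x

/-- `(I, J)` satisfies the conjunct when the function symbols are interpreted by `F`. -/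
def SOClause.Sat {D : Type} {S T : Schema} {Fn : Type} {ar : Fn → ℕ} (c : SOClause S T ar)
    (F : (f : Fn) → (Fin (ar f) → D) → D) (I : Inst D S) (J : Inst D T) : Prop :=
  ∀ v : Fin c.nx → D,
    (∀ a ∈ c.premiseRel, a.Holds I v) → (∀ e ∈ c.premiseEq, e.1.eval F v = e.2.eval F v) →
    (∀ b ∈ c.conclusionRel, b.Holds J (FnTerm.eval F v)) ∧
      ∀ e ∈ c.conclusionEq, e.1.eval F v = e.2.eval F v

/-- All terms of the conjunct have depth of nesting at most `d`. (The arguments of the relational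
atoms of the premise are variables, which have depth `0`.) -/
def SOClause.DepthLE {S T : Schema} {Fn : Type} {ar : Fn → ℕ} (c : SOClause S T ar) (d : ℕ) :
    Prop :=
  (∀ e ∈ c.premiseEq, e.1.depth ≤ d ∧ e.2.depth ≤ d) ∧
  (∀ b ∈ c.conclusionRel, ∀ i, (b.args i).depth ≤ d) ∧
  (∀ e ∈ c.conclusionEq, e.1.depth ≤ d ∧ e.2.depth ≤ d)

/-- An st-SO dependency `∃ f̄ (∀ x̄₁ (φ₁ → ψ₁) ∧ ⋯ ∧ ∀ x̄ₙ (φₙ → ψₙ))` from `S` to `T`. -/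
structure StSO (S T : Schema) where
  Fn : Type
  finite_fn : Finite Fn
  arity : Fn → ℕ
  clauses : List (SOClause S T arity)

/-- `(I, J) ⊨ σ`. The existentially quantified functions range over functions on the whole countably
infinite domain `D`, which serves as the universe: it contains all values of `I` and `J` and
infinitely many others. -/
def StSO.Sat {D : Type} {S T : Schema} (σ : StSO S T) (I : Inst D S) (J : Inst D T) : Prop :=
  ∃ F : (f : σ.Fn) → (Fin (σ.arity f) → D) → D, ∀ c ∈ σ.clauses, c.Sat F I J

/-- The depth of nesting is at most `1`. -/
def StSO.Unnested {S T : Schema} (σ : StSO S T) : Prop :=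
  ∀ c ∈ σ.clauses, c.DepthLE 1

/-! ## Classes of schema mappings -/

/-- The schema mapping `(S, T, σ)` specified by a single st-SO dependency. -/
def StSO.mapping (D : Type) {S T : Schema} (σ : StSO S T) : SchemaMapping D S T :=
  {p | σ.Sat p.1 p.2}

/-- `M` is specified by a finite set of st-tgds and a finite set of t-egds (no t-tgds). -/
def IsTgdEgdMapping (D : Type) (S T : Schema) (M : SchemaMapping D S T) : Prop :=
  ∃ (A : Set (Tgd S T)) (E : Set (Egd T)), A.Finite ∧ E.Finite ∧
    ∀ (I : Inst D S) (J : Inst D T), (I, J) ∈ M ↔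
      (∀ τ ∈ A, τ.Sat I J) ∧ (∀ ε ∈ E, ε.Sat J)

/-- `M` is a standard schema mapping: it is specified by a finite set of st-tgds, a finite set of
t-egds and a finite weakly acyclic set of t-tgds. -/
def IsStandard (D : Type) (S T : Schema) (M : SchemaMapping D S T) : Prop :=
  ∃ (A : Set (Tgd S T)) (E : Set (Egd T)) (Γ : Set (Tgd T T)),
    A.Finite ∧ E.Finite ∧ Γ.Finite ∧ WeaklyAcyclic Γ ∧
    ∀ (I : Inst D S) (J : Inst D T), (I, J) ∈ M ↔
      (∀ τ ∈ A, τ.Sat I J) ∧ (∀ ε ∈ E, ε.Sat J) ∧ (∀ γ ∈ Γ, γ.Sat J J)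

/-- `M` is an SO-standard schema mapping: it is specified by an st-SO dependency, a finite set of
t-egds and a finite weakly acyclic set of t-tgds. -/
def IsSOStandard (D : Type) (S T : Schema) (M : SchemaMapping D S T) : Prop :=
  ∃ (σ : StSO S T) (E : Set (Egd T)) (Γ : Set (Tgd T T)),
    E.Finite ∧ Γ.Finite ∧ WeaklyAcyclic Γ ∧
    ∀ (I : Inst D S) (J : Inst D T), (I, J) ∈ M ↔
      σ.Sat I J ∧ (∀ ε ∈ E, ε.Sat J) ∧ (∀ γ ∈ Γ, γ.Sat J J)

/-- `M` is a composition `M₁ ∘ ⋯ ∘ Mₖ` of finitely many (`k ≥ 1`) schema mappings from the class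
`P`, through arbitrary intermediate schemas. -/
inductive IsFiniteComposition {D : Type} (P : (S T : Schema) → SchemaMapping D S T → Prop) :
    (S T : Schema) → SchemaMapping D S T → Prop
  | single {S T : Schema} {M : SchemaMapping D S T} (hM : P S T M) : IsFiniteComposition P S T M
  | comp {S T U : Schema} {M : SchemaMapping D S T} {N : SchemaMapping D T U}
      (hM : P S T M) (hN : IsFiniteComposition P T U N) :
      IsFiniteComposition P S U (SetRel.comp M N)

end DataExchange

open DataExchange

/-!
Every st-SO dependency `σ`, nested or not, already splits into two mappings, and all three parts of
the theorem follow from this one factorization (`StSO.mem_mapping_iff`).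

The middle schema `StSO.mid` has a copy of every source symbol, for every function symbol `f` a
symbol for a finite piece of the graph of `f`, and a binary symbol for a finite piece of the equality
relation. For a clause `φ → ψ` of `σ`, let `y_t` be a variable for each subterm `t` of the clause.
The first mapping demands, wherever the relational part of `φ` holds, values `y_t` together with
graph atoms `f(y_{t₁}, …, y_{tₖ}) = y_t` for all subterms `t = f(t₁, …, tₖ)`. Its egds make the graphs
functional and the equality symbol the identity, and enforce the equalities of `ψ`. The second
mapping exports the relational atoms of `ψ`, read off the variables `y_t`. No nesting of terms is
left, since every subterm has its own variable.

If `σ` holds with functions `F`, the restriction of their graphs to the finitely many values of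
subterms is an intermediate instance (`StSO.midInst`, `SOClause.body_holds_midInst`). Conversely an
intermediate instance gives partial functions, and any total extension of them assigns to `t` the
value of `y_t` (`SOClause.eval_of_body_holds`). Target egds and t-tgds of an SO-standard mapping
are simply attached to the second mapping.
-/

namespace DataExchange

/-! ### Dependencies over arbitrary finite types of variables -/

/-- Renaming of the arguments of an atom. -/
def Atom.map {S : Schema} {X Y : Type} (g : X → Y) (a : Atom S X) : Atom S Y :=
  ⟨a.rel, fun i => g (a.args i)⟩

theorem Atom.forall_mem_map_holds {D : Type} {S : Schema} {X Y : Type} {g : X → Y}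
    {l : List (Atom S X)} {I : Inst D S} {v : Y → D} :
    (∀ a ∈ l.map (Atom.map g), a.Holds I v) ↔ ∀ a ∈ l, a.Holds I (v ∘ g) :=
  List.forall_mem_map

/-- The tgd with universal variables `X` and existential variables `Y`, any two finite types. -/
noncomputable def Tgd.ofFinite {S T : Schema} (X Y : Type) [Finite X] [Finite Y]
    (premise : List (Atom S X)) (conclusion : List (Atom T (X ⊕ Y)))
    (safe : ∀ x, ∃ a ∈ premise, ∃ i, a.args i = x) : Tgd S T where
  nx := Nat.card X
  ny := Nat.card Y
  premise := premise.map (Atom.map (Finite.equivFin X))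
  conclusion := conclusion.map (Atom.map (Sum.map (Finite.equivFin X) (Finite.equivFin Y)))
  safe := fun x => by
    obtain ⟨a, ha, i, hi⟩ := safe ((Finite.equivFin X).symm x)
    exact ⟨_, List.mem_map_of_mem ha, i, by simp [Atom.map, hi]⟩

theorem Tgd.sat_ofFinite {D : Type} {S T : Schema} {X Y : Type} [Finite X] [Finite Y]
    {premise : List (Atom S X)} {conclusion : List (Atom T (X ⊕ Y))}
    {safe : ∀ x, ∃ a ∈ premise, ∃ i, a.args i = x} {I : Inst D S} {J : Inst D T} :
    (Tgd.ofFinite X Y premise conclusion safe).Sat I J ↔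
      ∀ v : X → D, (∀ a ∈ premise, a.Holds I v) →
        ∃ w : Y → D, ∀ b ∈ conclusion, b.Holds J (Sum.elim v w) := by
  have h : (Tgd.ofFinite X Y premise conclusion safe).Sat I J ↔
      ∀ v : Fin (Nat.card X) → D, (∀ a ∈ premise, a.Holds I (v ∘ Finite.equivFin X)) →
        ∃ w : Fin (Nat.card Y) → D, ∀ b ∈ conclusion,
          b.Holds J (Sum.elim v w ∘ Sum.map (Finite.equivFin X) (Finite.equivFin Y)) := by
    simp only [← Atom.forall_mem_map_holds]
    rfl
  simp only [h, Sum.elim_comp_map]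
  constructor
  · intro h v hv
    obtain ⟨w, hw⟩ := h (v ∘ (Finite.equivFin X).symm) (by simpa [Function.comp_assoc] using hv)
    exact ⟨w ∘ Finite.equivFin Y, by simpa [Function.comp_assoc] using hw⟩
  · intro h v hv
    obtain ⟨w, hw⟩ := h (v ∘ Finite.equivFin X) hv
    exact ⟨w ∘ (Finite.equivFin Y).symm, by simpa [Function.comp_assoc] using hw⟩

/-- The egd with variables `X`, any finite type. -/
noncomputable def Egd.ofFinite {T : Schema} (X : Type) [Finite X] (premise : List (Atom T X))
    (left right : X) (safe : ∀ x, ∃ a ∈ premise, ∃ i, a.args i = x) : Egd T where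
  nx := Nat.card X
  premise := premise.map (Atom.map (Finite.equivFin X))
  left := Finite.equivFin X left
  right := Finite.equivFin X right
  safe := fun x => by
    obtain ⟨a, ha, i, hi⟩ := safe ((Finite.equivFin X).symm x)
    exact ⟨_, List.mem_map_of_mem ha, i, by simp [Atom.map, hi]⟩

theorem Egd.sat_ofFinite {D : Type} {T : Schema} {X : Type} [Finite X]
    {premise : List (Atom T X)} {left right : X}
    {safe : ∀ x, ∃ a ∈ premise, ∃ i, a.args i = x} {J : Inst D T} :
    (Egd.ofFinite X premise left right safe).Sat J ↔
      ∀ v : X → D, (∀ a ∈ premise, a.Holds J v) → v left = v right := by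
  have h : (Egd.ofFinite X premise left right safe).Sat J ↔
      ∀ v : Fin (Nat.card X) → D, (∀ a ∈ premise, a.Holds J (v ∘ Finite.equivFin X)) →
        v (Finite.equivFin X left) = v (Finite.equivFin X right) := by
    simp only [← Atom.forall_mem_map_holds]
    rfl
  rw [h]
  constructor
  · intro h v hv
    simpa using h (v ∘ (Finite.equivFin X).symm) (by simpa [Function.comp_assoc] using hv)
  · exact fun h v hv => h (v ∘ Finite.equivFin X) hv

/-! ### Subterms -/

/-- The set of subterms of a term, the term itself included. -/
def FnTerm.subterms {Fn : Type} {ar : Fn → ℕ} {X : Type} : FnTerm ar X → Set (FnTerm ar X)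
  | .var x => {.var x}
  | .app f args => insert (.app f args) (⋃ i, (args i).subterms)

theorem FnTerm.self_mem_subterms {Fn : Type} {ar : Fn → ℕ} {X : Type} (t : FnTerm ar X) :
    t ∈ t.subterms := by
  cases t <;> simp [FnTerm.subterms]

theorem FnTerm.finite_subterms {Fn : Type} {ar : Fn → ℕ} {X : Type} (t : FnTerm ar X) :
    t.subterms.Finite := by
  induction t with
  | var x => exact Set.finite_singleton _
  | app f args ih => exact (Set.finite_iUnion ih).insert _

theorem FnTerm.args_mem_subterms {Fn : Type} {ar : Fn → ℕ} {X : Type} {t : FnTerm ar X} {f : Fn}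
    {args : Fin (ar f) → FnTerm ar X} (h : FnTerm.app f args ∈ t.subterms) (i : Fin (ar f)) :
    args i ∈ t.subterms := by
  induction t with
  | var x => simp [FnTerm.subterms] at h
  | app g args' ih =>
    rcases h with h | h
    · cases h
      exact Or.inr (Set.mem_iUnion.2 ⟨i, self_mem_subterms _⟩)
    · obtain ⟨j, hj⟩ := Set.mem_iUnion.1 h
      exact Or.inr (Set.mem_iUnion.2 ⟨j, ih j hj⟩)

section Clause

variable {S T : Schema} {Fn : Type} {ar : Fn → ℕ}

/-- The terms that are sides of equalities or arguments of conclusion atoms of a clause. -/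
def SOClause.topTerms (c : SOClause S T ar) : Set (FnTerm ar (Fin c.nx)) :=
  (⋃ e ∈ {e | e ∈ c.premiseEq ++ c.conclusionEq}, {e.1, e.2}) ∪
    ⋃ b ∈ {b | b ∈ c.conclusionRel}, Set.range b.args

/-- All subterms of terms of a clause. -/
def SOClause.terms (c : SOClause S T ar) : Set (FnTerm ar (Fin c.nx)) :=
  ⋃ t ∈ c.topTerms, t.subterms

theorem SOClause.finite_terms (c : SOClause S T ar) : c.terms.Finite := by
  refine Set.Finite.biUnion (Set.Finite.union ?_ ?_) fun t _ => t.finite_subterms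
  · exact Set.Finite.biUnion (List.finite_toSet _) fun e _ => Set.toFinite _
  · exact Set.Finite.biUnion (List.finite_toSet _) fun b _ => Set.finite_range _

instance (c : SOClause S T ar) : Finite c.terms := c.finite_terms.to_subtype

theorem SOClause.args_mem_terms {c : SOClause S T ar} {f : Fn}
    {args : Fin (ar f) → FnTerm ar (Fin c.nx)} (h : FnTerm.app f args ∈ c.terms) (i : Fin (ar f)) :
    args i ∈ c.terms := by
  obtain ⟨t, ht, h⟩ := Set.mem_iUnion₂.1 h
  exact Set.mem_iUnion₂.2 ⟨t, ht, FnTerm.args_mem_subterms h i⟩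

theorem SOClause.mem_terms_of_mem_topTerms {c : SOClause S T ar} {t : FnTerm ar (Fin c.nx)}
    (h : t ∈ c.topTerms) : t ∈ c.terms :=
  Set.mem_iUnion₂.2 ⟨t, h, t.self_mem_subterms⟩

theorem SOClause.premiseEq_mem_terms {c : SOClause S T ar} {e} (h : e ∈ c.premiseEq) :
    e.1 ∈ c.terms ∧ e.2 ∈ c.terms :=
  ⟨mem_terms_of_mem_topTerms (Or.inl (Set.mem_iUnion₂.2 ⟨e, by simp [h], by simp⟩)),
    mem_terms_of_mem_topTerms (Or.inl (Set.mem_iUnion₂.2 ⟨e, by simp [h], by simp⟩))⟩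

theorem SOClause.conclusionEq_mem_terms {c : SOClause S T ar} {e} (h : e ∈ c.conclusionEq) :
    e.1 ∈ c.terms ∧ e.2 ∈ c.terms :=
  ⟨mem_terms_of_mem_topTerms (Or.inl (Set.mem_iUnion₂.2 ⟨e, by simp [h], by simp⟩)),
    mem_terms_of_mem_topTerms (Or.inl (Set.mem_iUnion₂.2 ⟨e, by simp [h], by simp⟩))⟩

theorem SOClause.conclusionRel_mem_terms {c : SOClause S T ar} {b} (h : b ∈ c.conclusionRel) (i) :
    b.args i ∈ c.terms :=
  mem_terms_of_mem_topTerms (Or.inr (Set.mem_iUnion₂.2 ⟨b, h, i, rfl⟩))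

/-- A valuation that satisfies the relational premise takes only values that occur in the source
instance, by the safety condition. -/
theorem SOClause.finite_valuations {D : Type} (c : SOClause S T ar) (I : Inst D S) :
    {v : Fin c.nx → D | ∀ a ∈ c.premiseRel, a.Holds I v}.Finite := by
  have := S.finite_rel
  have hA : (⋃ R, ⋃ t ∈ I.rel R, Set.range t).Finite :=
    Set.finite_iUnion fun R => (I.finite_rel R).biUnion fun t _ => Set.finite_range t
  refine (Set.Finite.pi' fun _ : Fin c.nx => hA).subset fun v hv x => ?_
  obtain ⟨a, ha, i, rfl⟩ := c.safe x
  exact Set.mem_iUnion.2 ⟨a.rel, Set.mem_iUnion₂.2 ⟨_, hv a ha, i, rfl⟩⟩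

/-! ### The middle schema -/

/-- The schema with a copy `inl R` of each symbol of `S`, a symbol `inr (some f)` for the graph of
each function symbol `f`, and a binary symbol `inr none` for equality. In a graph tuple the value
comes first and the arguments follow. -/
def graphSchema (S : Schema) [Finite Fn] (ar : Fn → ℕ) : Schema where
  Rel := S.Rel ⊕ Option Fn
  finite_rel := have := S.finite_rel; inferInstance
  arity
    | .inl R => S.arity R
    | .inr none => 2
    | .inr (some f) => ar f + 1
  arity_pos
    | .inl R => S.arity_pos R
    | .inr none => Nat.two_pos
    | .inr (some _) => Nat.succ_pos _

variable [Finite Fn]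

/-- The copy of a source atom. -/
def copyAtom {X Y : Type} (ar : Fn → ℕ) (g : X → Y) (a : Atom S X) : Atom (graphSchema S ar) Y :=
  ⟨.inl a.rel, fun i => g (a.args i)⟩

/-- The atom stating that `x` and `y` are equal. -/
def eqAtom {X : Type} (S : Schema) (ar : Fn → ℕ) (x y : X) : Atom (graphSchema S ar) X :=
  ⟨.inr none, ![x, y]⟩

/-- The atom stating that `f` has the value `y` at `x`. -/
def graphAtom {X : Type} (S : Schema) (ar : Fn → ℕ) (f : Fn) (x : Fin (ar f) → X) (y : X) :
    Atom (graphSchema S ar) X :=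
  ⟨.inr (some f), (Fin.cons y x : Fin (ar f + 1) → X)⟩

/-- `(x, y)` belongs to the equality symbol of `K`. -/
def Inst.EqHolds {D : Type} (K : Inst D (graphSchema S ar)) (x y : D) : Prop :=
  (![x, y] : Fin 2 → D) ∈ K.rel (.inr none)

/-- `(y, x)` belongs to the graph symbol of `f` in `K`. -/
def Inst.GraphHolds {D : Type} (K : Inst D (graphSchema S ar)) (f : Fn) (x : Fin (ar f) → D)
    (y : D) : Prop :=
  (Fin.cons y x : Fin (ar f + 1) → D) ∈ K.rel (.inr (some f))

theorem holds_copyAtom {D X Y : Type} {K : Inst D (graphSchema S ar)} {g : X → Y} {v : Y → D}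
    {a : Atom S X} : (copyAtom ar g a).Holds K v ↔ (fun i => v (g (a.args i))) ∈ K.rel (.inl a.rel) :=
  Iff.rfl

theorem holds_eqAtom {D X : Type} {K : Inst D (graphSchema S ar)} {v : X → D} {x y : X} :
    (eqAtom S ar x y).Holds K v ↔ K.EqHolds (v x) (v y) := by
  have : (fun i : Fin 2 => v ((![x, y] : Fin 2 → X) i)) = ![v x, v y] := by
    ext i; fin_cases i <;> rfl
  unfold Inst.EqHolds
  rw [← this]
  rfl

theorem holds_graphAtom {D X : Type} {K : Inst D (graphSchema S ar)} {v : X → D} {f : Fn}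
    {x : Fin (ar f) → X} {y : X} :
    (graphAtom S ar f x y).Holds K v ↔ K.GraphHolds f (fun i => v (x i)) (v y) := by
  have : (fun i : Fin (ar f + 1) => v ((Fin.cons y x : Fin (ar f + 1) → X) i)) =
      Fin.cons (v y) (fun i => v (x i)) := by
    ext i; refine Fin.cases ?_ (fun i => ?_) i <;> simp
  unfold Inst.GraphHolds
  rw [← this]
  rfl

/-! ### The translation of a clause -/

/-- The variables of the translation of a clause: its own variables, and one variable for each
subterm. -/
abbrev SOClause.Var (c : SOClause S T ar) : Type := Fin c.nx ⊕ c.terms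

/-- The atom that determines the variable of a subterm from those of its immediate subterms. -/
def SOClause.linkAtom (c : SOClause S T ar) : c.terms → Atom (graphSchema S ar) c.Var
  | ⟨.var x, h⟩ => eqAtom S ar (.inl x) (.inr ⟨.var x, h⟩)
  | ⟨.app f args, h⟩ =>
    graphAtom S ar f (fun i => .inr ⟨args i, args_mem_terms h i⟩) (.inr ⟨.app f args, h⟩)

/-- The relational premise of a clause together with the defining atoms of all subterms. The atom
`y = y` for each subterm variable `y` makes equalities of subterms visible in the middle schema. -/
noncomputable def SOClause.body (c : SOClause S T ar) : List (Atom (graphSchema S ar) c.Var) :=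
  have := Fintype.ofFinite c.terms
  c.premiseRel.map (copyAtom ar Sum.inl) ++
    (Finset.univ.toList.map c.linkAtom ++
      Finset.univ.toList.map fun t => eqAtom S ar (.inr t) (.inr t))

theorem SOClause.body_holds_iff {D : Type} {c : SOClause S T ar} {K : Inst D (graphSchema S ar)}
    {u : c.Var → D} :
    (∀ a ∈ c.body, a.Holds K u) ↔
      (∀ a ∈ c.premiseRel, (fun i => u (.inl (a.args i))) ∈ K.rel (.inl a.rel)) ∧
      (∀ t, (c.linkAtom t).Holds K u) ∧ ∀ t, K.EqHolds (u (.inr t)) (u (.inr t)) := by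
  simp only [body, List.forall_mem_append, List.forall_mem_map, Finset.mem_toList, Finset.mem_univ,
    forall_true_left, holds_eqAtom, holds_copyAtom]

/-- The body of a clause together with the equalities of its premise. -/
noncomputable def SOClause.fullBody (c : SOClause S T ar) : List (Atom (graphSchema S ar) c.Var) :=
  c.body ++ c.premiseEq.attach.map fun e =>
    eqAtom S ar (.inr ⟨e.1.1, (premiseEq_mem_terms e.2).1⟩)
      (.inr ⟨e.1.2, (premiseEq_mem_terms e.2).2⟩)

theorem SOClause.fullBody_holds_iff {D : Type} {c : SOClause S T ar}
    {K : Inst D (graphSchema S ar)} {u : c.Var → D} :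
    (∀ a ∈ c.fullBody, a.Holds K u) ↔ (∀ a ∈ c.body, a.Holds K u) ∧
      ∀ e (h : e ∈ c.premiseEq), K.EqHolds (u (.inr ⟨e.1, (premiseEq_mem_terms h).1⟩))
        (u (.inr ⟨e.2, (premiseEq_mem_terms h).2⟩)) := by
  simp only [fullBody, List.forall_mem_append, List.forall_mem_map, holds_eqAtom]
  refine and_congr_right fun _ => ⟨fun h e he => h ⟨e, he⟩ (List.mem_attach _ _), ?_⟩
  exact fun h e _ => h e.1 e.2

theorem SOClause.fullBody_safe (c : SOClause S T ar) (x : c.Var) :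
    ∃ a ∈ c.fullBody, ∃ i, a.args i = x := by
  rcases x with x | t
  · obtain ⟨a, ha, i, rfl⟩ := c.safe x
    refine ⟨copyAtom ar Sum.inl a, ?_, i, rfl⟩
    simp only [fullBody, body, List.mem_append]
    exact Or.inl (Or.inl (List.mem_map_of_mem ha))
  · refine ⟨eqAtom S ar (.inr t) (.inr t), ?_, (0 : Fin 2), rfl⟩
    simp only [fullBody, body, List.mem_append, List.mem_map]
    exact Or.inl (Or.inr (Or.inr ⟨t, by simp, rfl⟩))

/-- Whenever the relational premise holds, all subterms have values. -/
noncomputable def SOClause.valueTgd (c : SOClause S T ar) : Tgd S (graphSchema S ar) :=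
  Tgd.ofFinite (Fin c.nx) c.terms c.premiseRel c.body c.safe

/-- The equality `e` in the conclusion of a clause. -/
noncomputable def SOClause.conclusionEgd (c : SOClause S T ar) (e : {e // e ∈ c.conclusionEq}) :
    Egd (graphSchema S ar) :=
  Egd.ofFinite c.Var c.fullBody (.inr ⟨e.1.1, (conclusionEq_mem_terms e.2).1⟩)
    (.inr ⟨e.1.2, (conclusionEq_mem_terms e.2).2⟩) c.fullBody_safe

/-- The relational atoms in the conclusion of a clause. -/
noncomputable def SOClause.exportTgd (c : SOClause S T ar) : Tgd (graphSchema S ar) T :=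
  Tgd.ofFinite c.Var Empty c.fullBody
    (c.conclusionRel.attach.map fun b =>
      ⟨b.1.rel, fun i => .inl (.inr ⟨b.1.args i, conclusionRel_mem_terms b.2 i⟩)⟩)
    c.fullBody_safe

theorem SOClause.sat_exportTgd {D : Type} {c : SOClause S T ar} {K : Inst D (graphSchema S ar)}
    {J : Inst D T} :
    c.exportTgd.Sat K J ↔ ∀ u : c.Var → D, (∀ a ∈ c.fullBody, a.Holds K u) →
      ∀ b (h : b ∈ c.conclusionRel),
        (fun i => u (.inr ⟨b.args i, conclusionRel_mem_terms h i⟩)) ∈ J.rel b.rel := by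
  rw [exportTgd, Tgd.sat_ofFinite]
  simp only [List.forall_mem_map]
  refine forall₂_congr fun u _ => ⟨?_, ?_⟩
  · rintro ⟨w, hw⟩ b hb
    exact hw ⟨b, hb⟩ (List.mem_attach _ _)
  · exact fun h => ⟨Empty.elim, fun b _ => h b.1 b.2⟩

/-- The values of a function are unique. -/
noncomputable def functionalEgd (S : Schema) (ar : Fn → ℕ) (f : Fn) : Egd (graphSchema S ar) :=
  Egd.ofFinite (Fin (ar f) ⊕ Bool)
    [graphAtom S ar f Sum.inl (.inr true), graphAtom S ar f Sum.inl (.inr false)]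
    (.inr true) (.inr false) (by
      rintro (i | _ | _)
      · exact ⟨graphAtom S ar f Sum.inl (.inr true), by simp, i.succ, rfl⟩
      · exact ⟨graphAtom S ar f Sum.inl (.inr false), by simp, (0 : Fin (ar f + 1)), rfl⟩
      · exact ⟨graphAtom S ar f Sum.inl (.inr true), by simp, (0 : Fin (ar f + 1)), rfl⟩)

theorem sat_functionalEgd {D : Type} {K : Inst D (graphSchema S ar)} {f : Fn} :
    (functionalEgd S ar f).Sat K ↔
      ∀ x y z, K.GraphHolds f x y → K.GraphHolds f x z → y = z := by
  rw [functionalEgd, Egd.sat_ofFinite]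
  simp only [List.forall_mem_cons, holds_graphAtom]
  constructor
  · intro h x y z hy hz
    exact h (Sum.elim x fun b => if b then y else z) ⟨by simpa using hy, by simpa using hz, by simp⟩
  · rintro h v ⟨h₁, h₂, -⟩
    exact h _ _ _ h₁ h₂

/-- The equality symbol is contained in the identity. -/
noncomputable def identityEgd (S : Schema) (ar : Fn → ℕ) : Egd (graphSchema S ar) :=
  Egd.ofFinite Bool [eqAtom S ar true false] true false (by
    rintro (_ | _)
    · exact ⟨eqAtom S ar true false, by simp, (1 : Fin 2), rfl⟩
    · exact ⟨eqAtom S ar true false, by simp, (0 : Fin 2), rfl⟩)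

theorem sat_identityEgd {D : Type} {K : Inst D (graphSchema S ar)} :
    (identityEgd S ar).Sat K ↔ ∀ x y, K.EqHolds x y → x = y := by
  rw [identityEgd, Egd.sat_ofFinite]
  simp only [List.forall_mem_cons, holds_eqAtom]
  constructor
  · intro h x y hxy
    exact h (fun b => if b then x else y) ⟨by simpa using hxy, by simp⟩
  · rintro h v ⟨h₁, -⟩
    exact h _ _ h₁

/-! ### Values of subterm variables -/

/-- If the graphs in `K` are parts of the graphs of `F` and the equality symbol is part of the
identity, then each subterm variable has the value of its subterm. -/
theorem SOClause.eval_of_body_holds {D : Type} {c : SOClause S T ar}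
    {K : Inst D (graphSchema S ar)} {F : (f : Fn) → (Fin (ar f) → D) → D}
    (hF : ∀ f x y, K.GraphHolds f x y → F f x = y) (hE : ∀ x y, K.EqHolds x y → x = y)
    {u : c.Var → D} (hu : ∀ a ∈ c.body, a.Holds K u) (t : FnTerm ar (Fin c.nx))
    (ht : t ∈ c.terms) : u (.inr ⟨t, ht⟩) = t.eval F fun x => u (.inl x) := by
  have hlink := (body_holds_iff.1 hu).2.1
  induction t with
  | var x => exact (hE _ _ (holds_eqAtom.1 (hlink ⟨.var x, ht⟩))).symm
  | app f args ih =>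
    rw [← hF _ _ _ (holds_graphAtom.1 (hlink ⟨.app f args, ht⟩)), FnTerm.eval]
    congr 1
    ext i
    exact ih i (args_mem_terms ht i)

/-- The finite instance of the middle schema determined by functions `F` and a finite set `B`: the
graphs of `F` are restricted to arguments in `B`, and equality to `B`. -/
def midInst {D : Type} (I : Inst D S) (F : (f : Fn) → (Fin (ar f) → D) → D) (B : Set D)
    (hB : B.Finite) : Inst D (graphSchema S ar) where
  rel
    | .inl R => I.rel R
    | .inr none => (fun b => ![b, b]) '' B
    | .inr (some f) => (fun x => (Fin.cons (F f x) x : Fin (ar f + 1) → D)) '' {x | ∀ i, x i ∈ B}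
  finite_rel
    | .inl R => I.finite_rel R
    | .inr none => hB.image _
    | .inr (some _) => (Set.Finite.pi' fun _ => hB).image _

theorem eqHolds_midInst {D : Type} {I : Inst D S} {F : (f : Fn) → (Fin (ar f) → D) → D} {B : Set D}
    {hB : B.Finite} {x y : D} : (midInst I F B hB).EqHolds x y ↔ x ∈ B ∧ x = y := by
  constructor
  · rintro ⟨b, hb, h⟩
    have h0 : b = x := congrFun h (0 : Fin 2)
    have h1 : b = y := congrFun h (1 : Fin 2)
    exact ⟨h0 ▸ hb, h0 ▸ h1⟩
  · rintro ⟨hx, rfl⟩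
    exact ⟨x, hx, rfl⟩

theorem graphHolds_midInst {D : Type} {I : Inst D S} {F : (f : Fn) → (Fin (ar f) → D) → D}
    {B : Set D} {hB : B.Finite} {f : Fn} {x : Fin (ar f) → D} {y : D} :
    (midInst I F B hB).GraphHolds f x y ↔ (∀ i, x i ∈ B) ∧ F f x = y := by
  constructor
  · rintro ⟨x', hx', h⟩
    obtain ⟨h0, rfl⟩ := Fin.cons_injective2 (α := fun _ => D) h
    exact ⟨hx', h0⟩
  · rintro ⟨hx, rfl⟩
    exact ⟨x, hx, rfl⟩

/-- If `B` contains the values of all subterms, these values satisfy the body of the clause. -/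
theorem SOClause.body_holds_midInst {D : Type} {c : SOClause S T ar} {I : Inst D S}
    {F : (f : Fn) → (Fin (ar f) → D) → D} {B : Set D} {hB : B.Finite} {v : Fin c.nx → D}
    (hv : ∀ a ∈ c.premiseRel, a.Holds I v) (hvB : ∀ t ∈ c.terms, t.eval F v ∈ B) :
    ∀ a ∈ c.body, a.Holds (midInst I F B hB) (Sum.elim v fun t => t.1.eval F v) := by
  refine body_holds_iff.2 ⟨hv, ?_, fun t => eqHolds_midInst.2 ⟨hvB t.1 t.2, rfl⟩⟩
  rintro ⟨t, ht⟩
  cases t with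
  | var x => exact holds_eqAtom.2 (eqHolds_midInst.2 ⟨hvB _ ht, rfl⟩)
  | app f args =>
    exact holds_graphAtom.2 (graphHolds_midInst.2 ⟨fun i => hvB _ (args_mem_terms ht i), rfl⟩)

end Clause

/-! ### The factorization -/

section Factorization

variable {S T : Schema} (σ : StSO S T)

instance : Finite σ.Fn := σ.finite_fn

/-- The middle schema of the factorization of `σ`. -/
abbrev StSO.mid : Schema := graphSchema S σ.arity

/-- The st-tgds of the first mapping. -/
def StSO.valueTgds : Set (Tgd S σ.mid) := SOClause.valueTgd '' {c | c ∈ σ.clauses}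

/-- The egds of the first mapping. -/
def StSO.midEgds : Set (Egd σ.mid) :=
  insert (identityEgd S σ.arity) (Set.range (functionalEgd S σ.arity)) ∪
    ⋃ c ∈ {c | c ∈ σ.clauses}, Set.range c.conclusionEgd

/-- The st-tgds of the second mapping. -/
def StSO.exportTgds : Set (Tgd σ.mid T) := SOClause.exportTgd '' {c | c ∈ σ.clauses}

theorem StSO.finite_valueTgds : σ.valueTgds.Finite := (List.finite_toSet _).image _

theorem StSO.finite_exportTgds : σ.exportTgds.Finite := (List.finite_toSet _).image _

theorem StSO.finite_midEgds : σ.midEgds.Finite := by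
  refine ((Set.finite_range _).insert _).union ((List.finite_toSet _).biUnion fun c _ => ?_)
  have : Finite {e // e ∈ c.conclusionEq} := (List.finite_toSet c.conclusionEq).to_subtype
  exact Set.finite_range _

theorem StSO.sat_midEgds_iff {D : Type} {K : Inst D σ.mid} :
    (∀ ε ∈ σ.midEgds, ε.Sat K) ↔
      (∀ x y, K.EqHolds x y → x = y) ∧
      (∀ f x y z, K.GraphHolds f x y → K.GraphHolds f x z → y = z) ∧
      ∀ c ∈ σ.clauses, ∀ u : c.Var → D, (∀ a ∈ c.fullBody, a.Holds K u) →
        ∀ e (h : e ∈ c.conclusionEq), u (.inr ⟨e.1, (SOClause.conclusionEq_mem_terms h).1⟩) =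
          u (.inr ⟨e.2, (SOClause.conclusionEq_mem_terms h).2⟩) := by
  have h : (∀ ε ∈ σ.midEgds, ε.Sat K) ↔ (identityEgd S σ.arity).Sat K ∧
      (∀ f, (functionalEgd S σ.arity f).Sat K) ∧
      ∀ c ∈ σ.clauses, ∀ e, (c.conclusionEgd e).Sat K := by
    constructor
    · refine fun h => ⟨h _ (Or.inl (Or.inl rfl)), fun f => h _ (Or.inl (Or.inr ⟨f, rfl⟩)), ?_⟩
      exact fun c hc e => h _ (Or.inr (Set.mem_iUnion₂.2 ⟨c, hc, e, rfl⟩))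
    · rintro ⟨h₁, h₂, h₃⟩ ε ((rfl | ⟨f, rfl⟩) | hε)
      · exact h₁
      · exact h₂ f
      · obtain ⟨c, hc, e, rfl⟩ := Set.mem_iUnion₂.1 hε
        exact h₃ c hc e
  rw [h, sat_identityEgd]
  simp only [sat_functionalEgd, SOClause.conclusionEgd, Egd.sat_ofFinite]
  refine and_congr_right fun _ => and_congr_right fun _ => forall₂_congr fun c hc => ?_
  exact ⟨fun h u hu e he => h ⟨e, he⟩ u hu, fun h e u hu => h u hu e.1 e.2⟩

theorem StSO.mem_mapping_iff {D : Type} [Nonempty D] {I : Inst D S} {J : Inst D T} :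
    (I, J) ∈ σ.mapping D ↔ ∃ K : Inst D σ.mid, ((∀ τ ∈ σ.valueTgds, τ.Sat I K) ∧
      ∀ ε ∈ σ.midEgds, ε.Sat K) ∧ ∀ τ ∈ σ.exportTgds, τ.Sat K J := by
  simp only [sat_midEgds_iff, valueTgds, exportTgds, Set.forall_mem_image, Set.mem_ofPred_eq]
  constructor
  · rintro ⟨F, hF⟩
    have hB : (⋃ c ∈ {c | c ∈ σ.clauses}, ⋃ v ∈ {v | ∀ a ∈ c.premiseRel, a.Holds I v},
        (fun t => FnTerm.eval F v t) '' c.terms).Finite :=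
      (List.finite_toSet _).biUnion fun c _ => (c.finite_valuations I).biUnion fun v _ =>
        c.finite_terms.image _
    have hG : ∀ f x y, (midInst I F _ hB).GraphHolds f x y → F f x = y :=
      fun f x y h => (graphHolds_midInst.1 h).2
    have hE : ∀ x y, (midInst I F _ hB).EqHolds x y → x = y :=
      fun x y h => (eqHolds_midInst.1 h).2
    -- A valuation of the translated clause is one that satisfies the whole premise of the clause.
    have key : ∀ c ∈ σ.clauses, ∀ u : c.Var → D, (∀ a ∈ c.fullBody, a.Holds (midInst I F _ hB) u) →
        (∀ t ht, u (.inr ⟨t, ht⟩) = t.eval F fun x => u (.inl x)) ∧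
        (∀ b ∈ c.conclusionRel, b.Holds J (FnTerm.eval F fun x => u (.inl x))) ∧
        ∀ e ∈ c.conclusionEq, (e.1.eval F fun x => u (.inl x)) = e.2.eval F fun x => u (.inl x) := by
      intro c hc u hu
      obtain ⟨hb, he⟩ := SOClause.fullBody_holds_iff.1 hu
      have hval := SOClause.eval_of_body_holds hG hE hb
      refine ⟨hval, hF c hc _ (SOClause.body_holds_iff.1 hb).1 fun e h => ?_⟩
      rw [← hval _ (SOClause.premiseEq_mem_terms h).1, ← hval _ (SOClause.premiseEq_mem_terms h).2]
      exact hE _ _ (he e h)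
    refine ⟨midInst I F _ hB, ⟨fun c hc => Tgd.sat_ofFinite.2 fun v hv => ?_, hE, ?_, ?_⟩, ?_⟩
    · refine ⟨_, SOClause.body_holds_midInst hv fun t ht => ?_⟩
      exact Set.mem_iUnion₂.2 ⟨c, hc, Set.mem_iUnion₂.2 ⟨v, hv, t, ht, rfl⟩⟩
    · intro f x y z hy hz
      rw [← hG f x y hy, ← hG f x z hz]
    · intro c hc u hu e he
      obtain ⟨hval, -, h⟩ := key c hc u hu
      rw [hval, hval]
      exact h e he
    · intro c hc
      refine SOClause.sat_exportTgd.2 fun u hu b hb => ?_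
      obtain ⟨hval, h, -⟩ := key c hc u hu
      simp only [hval]
      exact h b hb
  · rintro ⟨K, ⟨hV, hE, hf, hC⟩, hX⟩
    classical
    -- The functions extend the partial functions given by `K`; outside of them any value will do.
    let F : (f : σ.Fn) → (Fin (σ.arity f) → D) → D := fun f x =>
      if h : ∃ y, K.GraphHolds f x y then h.choose else Classical.arbitrary D
    have hG : ∀ f x y, K.GraphHolds f x y → F f x = y := by
      intro f x y h
      have h' : ∃ y, K.GraphHolds f x y := ⟨y, h⟩
      simp only [F, dif_pos h']
      exact hf f x _ _ h'.choose_spec h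
    refine ⟨F, fun c hc v hv he => ?_⟩
    obtain ⟨w, hw⟩ := Tgd.sat_ofFinite.1 (hV hc) v hv
    have hval : ∀ t ht, w ⟨t, ht⟩ = t.eval F v := SOClause.eval_of_body_holds hG hE hw
    have hfull : ∀ a ∈ c.fullBody, a.Holds K (Sum.elim v w) := by
      refine SOClause.fullBody_holds_iff.2 ⟨hw, fun e h => ?_⟩
      have heq : w ⟨e.1, (SOClause.premiseEq_mem_terms h).1⟩ =
          w ⟨e.2, (SOClause.premiseEq_mem_terms h).2⟩ := by
        rw [hval, hval]; exact he e h
      simp only [Sum.elim_inr]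
      rw [← heq]
      exact (SOClause.body_holds_iff.1 hw).2.2 _
    constructor
    · intro b hb
      have := SOClause.sat_exportTgd.1 (hX hc) _ hfull b hb
      simp only [Sum.elim_inr, hval] at this
      exact this
    · intro e h
      rw [← hval _ (SOClause.conclusionEq_mem_terms h).1,
        ← hval _ (SOClause.conclusionEq_mem_terms h).2]
      exact hC c hc _ hfull e h

/-- The first mapping of the factorization. -/
def StSO.toMid (D : Type) : SchemaMapping D S σ.mid :=
  {p | (∀ τ ∈ σ.valueTgds, τ.Sat p.1 p.2) ∧ ∀ ε ∈ σ.midEgds, ε.Sat p.2}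

/-- The second mapping of the factorization. -/
def StSO.fromMid (D : Type) : SchemaMapping D σ.mid T :=
  {p | ∀ τ ∈ σ.exportTgds, τ.Sat p.1 p.2}

theorem StSO.mapping_eq_comp (D : Type) [Nonempty D] :
    σ.mapping D = SetRel.comp (σ.toMid D) (σ.fromMid D) :=
  Set.ext fun _ => σ.mem_mapping_iff

theorem StSO.isTgdEgdMapping_toMid (D : Type) : IsTgdEgdMapping D S σ.mid (σ.toMid D) :=
  ⟨_, _, σ.finite_valueTgds, σ.finite_midEgds, fun _ _ => Iff.rfl⟩

theorem StSO.isTgdEgdMapping_fromMid (D : Type) : IsTgdEgdMapping D σ.mid T (σ.fromMid D) :=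
  ⟨_, ∅, σ.finite_exportTgds, Set.finite_empty, fun _ _ => by simp [fromMid]⟩

end Factorization

theorem weaklyAcyclic_empty (T : Schema) : WeaklyAcyclic (∅ : Set (Tgd T T)) := by
  rintro p q ⟨τ, hτ, -⟩
  exact absurd hτ (Set.notMem_empty τ)

theorem IsTgdEgdMapping.isStandard {D : Type} {S T : Schema} {M : SchemaMapping D S T}
    (h : IsTgdEgdMapping D S T M) : IsStandard D S T M := by
  obtain ⟨A, E, hA, hE, h⟩ := h
  exact ⟨A, E, ∅, hA, hE, Set.finite_empty, weaklyAcyclic_empty T, fun I J => by simp [h]⟩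

end DataExchange

open DataExchange
theorem theorem6p7 (D : Type) [Countable D] [Infinite D] :
    (∀ (S T : Schema) (M : SchemaMapping D S T), IsSOStandard D S T M →
      IsFiniteComposition (IsStandard D) S T M) ∧
    (∀ (S T : Schema) (σ : StSO S T),
      IsFiniteComposition (IsTgdEgdMapping D) S T (σ.mapping D)) ∧
    (∀ (S T : Schema) (σ : StSO S T), σ.Unnested →
      ∃ (S₂ : Schema) (M₁₂ : SchemaMapping D S S₂) (M₂₃ : SchemaMapping D S₂ T),
        IsTgdEgdMapping D S S₂ M₁₂ ∧ IsTgdEgdMapping D S₂ T M₂₃ ∧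
        σ.mapping D = SetRel.comp M₁₂ M₂₃) := by
  refine ⟨?_, fun S T σ => ?_, fun S T σ _ => ?_⟩
  · rintro S T M ⟨σ, E, Γ, hE, hΓ, hac, hM⟩
    let N : SchemaMapping D σ.mid T := {p | (∀ τ ∈ σ.exportTgds, τ.Sat p.1 p.2) ∧
      (∀ ε ∈ E, ε.Sat p.2) ∧ ∀ γ ∈ Γ, γ.Sat p.2 p.2}
    have hN : IsStandard D σ.mid T N :=
      ⟨_, E, Γ, σ.finite_exportTgds, hE, hΓ, hac, fun _ _ => Iff.rfl⟩
    have hcomp : M = SetRel.comp (σ.toMid D) N := by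
      ext ⟨I, J⟩
      rw [hM]
      constructor
      · rintro ⟨hσ, hJ⟩
        obtain ⟨K, hK, hKJ⟩ := σ.mem_mapping_iff.1 hσ
        exact ⟨K, hK, hKJ, hJ⟩
      · rintro ⟨K, hK, hKJ, hJ⟩
        exact ⟨σ.mem_mapping_iff.2 ⟨K, hK, hKJ⟩, hJ⟩
    rw [hcomp]
    exact .comp (σ.isTgdEgdMapping_toMid D).isStandard (.single hN)
  · rw [σ.mapping_eq_comp D]
    exact .comp (σ.isTgdEgdMapping_toMid D) (.single (σ.isTgdEgdMapping_fromMid D))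
  · exact ⟨_, _, _, σ.isTgdEgdMapping_toMid D, σ.isTgdEgdMapping_fromMid D, σ.mapping_eq_comp D⟩
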